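/- Let $S$ be a topological space with a measure $\upsilon$ on a $\sigma$-algebra containing the Borel sets, such that every non-empty open set has positive measure and every point has an open neighbourhood of finite measure (for instance a complete Borel measure with these properties). Let $(X_s)_{s\in S}$ be a real, jointly measurable, centered process with $\mathbb E(X_s^2)<\infty$ for all $s$, whose covariance function $K(s,t)=\mathbb E(X_sX_t)$ is continuous on $S\times S$, and suppose that $\int_S\mathbb E(X_s^2)\,d\upsilon(s)<\infty$. Put $\mathcal K f(s)=\int_S K(s,t)f(t)\,d\upsilon(t)$ for $f\in L^2(S,\upsilon)$. (1) $K$ is a Mercer kernel, that is, there are numbers $a_1\ge a_2\ge\dots\ge 0$ with $a_j\to 0$ and continuous functions $\zeta_j\in L^2(S,\upsilon)$ with $\mathcal K\zeta_j=a_j\zeta_j$ such that the $\zeta_j$ with $a_j>0$ are orthonormal in $L^2(S,\upsilon)$ and form an orthonormal basis of $L^2(S,\upsilon)$ together with suitable functions annihilated by $\mathcal K$, and $$K(s,t)=\sum_{j=1}^\infty a_j\,\zeta_j(s)\,\zeta_j(t),\qquad s,t\in S,$$ where the series and the series of absolute values converge uniformly on compact subsets of $S\times S$. (A finite expansion is padded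 with terms $a_j=0$, $\zeta_j=0$.) (2) For every such expansion, $X$ has the Karhunen–Loève expansion $X_s=\sum_{j=1}^\infty\lambda_j\zeta_j(s)$ with $\lambda_j=\int_S X_s\zeta_j(s)\,d\upsilon(s)$. The integral converges almost surely, $\lambda_j$ is square integrable, and $\mathbb E[\lambda_j]=0$, $\mathbb E[\lambda_j\lambda_k]=\delta_{jk}a_j$, $\operatorname{Var}[\lambda_j]=a_j$. The expansion converges - in $L^2(S\times\Omega,\upsilon\otimes\mathbb P)$, where $(\upsilon\otimes\mathbb P)(A)=\int_S\mathbb P(A_s)\,d\upsilon(s)$ and $A_s=\{\omega:(s,\omega)\in A\}$; hence, if $\upsilon$ is $\sigma$-finite (or only $s$-finite), $\lim_{J\to\infty}\mathbb E\int_S\big(X_s-\sum_{j=1}^J\lambda_j\zeta_j(s)\big)^2d\upsilon(s)=0$; - in $L^2(\Omega)$ for every $s\in S$: $\lim_{J\to\infty}\mathbb E\big(X_s-\sum_{j=1}^J\lambda_j\zeta_j(s)\big)^2=0$; - in mean square uniformly on every compact subset of $S$ and unconditionally: for every compact $C\subseteq S$, $\sup_{s\in C}\mathbb E\big(X_s-\sum_{j\in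 F}\lambda_j\zeta_j(s)\big)^2\to 0$ along the directed set of finite $F\subset\{1,2,\dots\}$. Moreover $\sum_j\mathbb E\big[(\lambda_j\zeta_j(s))^2\big]=\mathbb E(X_s^2)$, uniformly for $s\in C$. -/

import Mathlib

open MeasureTheory ProbabilityTheory Filter Topology

noncomputable section

/-- The integral operator `𝒦 f (s) = ∫ K(s,t) f(t) dυ(t)` of a kernel `K` on `S`. -/
def integralOperator {S 𝕜 : Type*} [MeasurableSpace S] [RCLike 𝕜] (υ : Measure S)
    (K : S → S → 𝕜) (f : S → 𝕜) (s : S) : 𝕜 :=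
  ∫ t, K s t * f t ∂υ

/-- `K(s,t) = ∑ j, a j * ζ j s * conj (ζ j t)` is a Mercer expansion of the continuous kernel `K`.

The terms with `0 < a j` are the genuine ones; if the expansion is finite it is padded by terms
with `a j = 0` and `ζ j = 0`. -/
structure IsMercerExpansion {S 𝕜 : Type*} [TopologicalSpace S] [MeasurableSpace S] [RCLike 𝕜]
    (υ : Measure S) (K : S → S → 𝕜) (a : ℕ → ℝ) (ζ : ℕ → S → 𝕜) : Prop where
  continuous_kernel : Continuous (Function.uncurry K)
  /-- The integral operator of `K` is given on `L²(S, υ)` by convergent integrals. -/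
  memLp_kernel : ∀ s, MemLp (K s) 2 υ
  antitone : Antitone a
  tendsto_zero : Tendsto a atTop (𝓝 0)
  continuous_eigenfunction : ∀ j, Continuous (ζ j)
  memLp_eigenfunction : ∀ j, MemLp (ζ j) 2 υ
  eigenfunction_eq_zero : ∀ j, a j = 0 → ζ j = 0
  /-- The `a j` are eigenvalues of the integral operator, with eigenfunctions `ζ j`. -/
  eigen : ∀ j s, integralOperator υ K (ζ j) s = (a j : 𝕜) * ζ j s
  /-- The `ζ j` with `0 < a j`, together with a set `B` of functions annihilated by the integral
  operator, are an orthonormal basis of `L²(S, υ)`. -/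
  exists_basis : ∃ B : Set (Lp 𝕜 2 υ),
    (∀ g ∈ B, ∀ s, integralOperator υ K g s = 0) ∧
    Orthonormal 𝕜 (Sum.elim
      (fun j : {j : ℕ // 0 < a j} => (memLp_eigenfunction j).toLp (ζ j))
      (fun g : B => (g : Lp 𝕜 2 υ))) ∧
    (Submodule.span 𝕜 (Set.range (Sum.elim
      (fun j : {j : ℕ // 0 < a j} => (memLp_eigenfunction j).toLp (ζ j))
      (fun g : B => (g : Lp 𝕜 2 υ))))).topologicalClosure = ⊤
  hasSum : ∀ s t, HasSum (fun j => (a j : 𝕜) * ζ j s * starRingEnd 𝕜 (ζ j t)) (K s t)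
  /-- The series converges uniformly on compact subsets of `S × S`. -/
  tendstoUniformlyOn : ∀ C : Set (S × S), IsCompact C →
    TendstoUniformlyOn
      (fun (n : ℕ) (p : S × S) =>
        ∑ j ∈ Finset.range n, (a j : 𝕜) * ζ j p.1 * starRingEnd 𝕜 (ζ j p.2))
      (Function.uncurry K) atTop C
  /-- The series of absolute values converges, uniformly on compact subsets of `S × S`. -/
  tendstoUniformlyOn_norm : ∀ C : Set (S × S), IsCompact C →
    TendstoUniformlyOn
      (fun (n : ℕ) (p : S × S) =>
        ∑ j ∈ Finset.range n, ‖(a j : 𝕜) * ζ j p.1 * starRingEnd 𝕜 (ζ j p.2)‖)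
      (fun p => ∑' j, ‖(a j : 𝕜) * ζ j p.1 * starRingEnd 𝕜 (ζ j p.2)‖) atTop C

/-- A Mercer kernel: a continuous kernel that has a Mercer expansion. -/
def IsMercerKernel {S 𝕜 : Type*} [TopologicalSpace S] [MeasurableSpace S] [RCLike 𝕜]
    (υ : Measure S) (K : S → S → 𝕜) : Prop :=
  ∃ (a : ℕ → ℝ) (ζ : ℕ → S → 𝕜), IsMercerExpansion υ K a ζ

/-- The covariance function of a real process. -/
def covarianceKernel {S Ω : Type*} [MeasurableSpace Ω] (P : Measure Ω) (X : S → Ω → ℝ)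
    (s t : S) : ℝ :=
  cov[X s, X t; P]

/-- The random coefficient `∫ X_s φ(s) dυ(s)` of the process `X` along `φ`. -/
def klCoeff {S Ω : Type*} [MeasurableSpace S] (υ : Measure S) (X : S → Ω → ℝ) (φ : S → ℝ)
    (ω : Ω) : ℝ :=
  ∫ s, X s ω * φ s ∂υ

/-- The remainder `X_s - ∑ j ∈ F, λ_j ζ_j(s)` of the Karhunen-Loève series, where
`λ_j = ∫ X_s ζ_j(s) dυ(s)` and `F` is a finite set of indices. -/
def klRemainder {S Ω : Type*} [MeasurableSpace S] (υ : Measure S) (X : S → Ω → ℝ)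
    (ζ : ℕ → S → ℝ) (F : Finset ℕ) (s : S) (ω : Ω) : ℝ :=
  X s ω - ∑ j ∈ F, klCoeff υ X (ζ j) ω * ζ j s

end

/-! Write `Φ s` for the class of `X s` in `H = L²(P)`. As `X` is centered, `K(s,t) = ⟪Φ s, Φ t⟫`;
hence continuity of `K` makes `Φ` continuous, and `‖Φ s‖² = E X_s²` is integrable. Let `D : H →
L²(υ)` send `h` to `⟪Φ ·, h⟫`. Integrating Bessel's inequality shows that `D` is Hilbert-Schmidt,
and `D D*` is the integral operator of `K`.

For Mercer's theorem, `D* D` is diagonalised on `H`, rather than `D D*` on `L²(υ)`. A unit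
eigenvector `b` with eigenvalue `a > 0` gives the continuous eigenfunction `a^(-1/2) ⟪Φ ·, b⟫`, and
Parseval's identity for `Φ s` and `Φ t` is the expansion at every pair of points. Null eigenvectors
drop out: there `⟪Φ ·, b⟫` is continuous and vanishes almost everywhere, hence everywhere. Dini's
theorem gives uniformity on the diagonal, and `2|xy| ≤ x² + y²` carries it to `S × S`.

For the Karhunen-Loève part, Fubini identifies `λ_j` with `D* ζ_j`. Covariances become `⟪ζ_j, D D*
ζ_k⟫ = δ_jk a_j`, and the remainder over `F` has second moment `K(s,s) - ∑_{j ∈ F} a_j ζ_j(s)²`.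
Every mode of convergence is thus that of the diagonal Mercer series: pointwise, uniform by Dini, or
integrated by dominated convergence. -/

/-! ### Compact operators and eigenbases -/

/-- An operator with square-summable images of a Hilbert basis (a Hilbert-Schmidt operator) is
compact. -/
theorem HilbertBasis.isCompactOperator_of_summable_norm_sq {ι 𝕜 H E : Type*} [RCLike 𝕜]
    [NormedAddCommGroup H] [InnerProductSpace 𝕜 H] [NormedAddCommGroup E] [NormedSpace 𝕜 E]
    [CompleteSpace E] (b : HilbertBasis ι 𝕜 H) (T : H →L[𝕜] E)
    (hT : Summable fun i => ‖T (b i)‖ ^ 2) : IsCompactOperator T := by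
  -- Rank-one pieces of `T`. Cauchy-Schwarz and Bessel bound their finite sums in operator norm by
  -- tails of the square sum, so `T` is a norm limit of finite-rank operators.
  set R : ι → H →L[𝕜] E := fun i => (innerSL 𝕜 (b i)).smulRight (T (b i)) with hR
  have hR_apply : ∀ i x, R i x = inner 𝕜 (b i) x • T (b i) := fun i x => rfl
  have hbound : ∀ G : Finset ι, ‖∑ i ∈ G, R i‖ ≤ √(∑ i ∈ G, ‖T (b i)‖ ^ 2) := by
    intro G
    refine ContinuousLinearMap.opNorm_le_bound _ (Real.sqrt_nonneg _) fun x => ?_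
    rw [_root_.sum_apply]
    calc ‖∑ i ∈ G, R i x‖ ≤ ∑ i ∈ G, ‖(inner 𝕜 (b i) x : 𝕜)‖ * ‖T (b i)‖ :=
          (norm_sum_le _ _).trans_eq (Finset.sum_congr rfl fun i _ => by
            rw [hR_apply, norm_smul])
      _ ≤ √(∑ i ∈ G, ‖(inner 𝕜 (b i) x : 𝕜)‖ ^ 2) * √(∑ i ∈ G, ‖T (b i)‖ ^ 2) :=
          Real.sum_mul_le_sqrt_mul_sqrt _ _ _
      _ ≤ ‖x‖ * √(∑ i ∈ G, ‖T (b i)‖ ^ 2) := by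
          gcongr
          exact Real.sqrt_le_iff.2 ⟨norm_nonneg _, b.orthonormal.sum_inner_products_le x⟩
      _ = _ := mul_comm _ _
  have hsum : Summable R := by
    rw [summable_iff_vanishing_norm]
    intro ε hε
    obtain ⟨F, hF⟩ := summable_iff_vanishing_norm.1 hT (ε ^ 2) (by positivity)
    refine ⟨F, fun G hG => (hbound G).trans_lt ?_⟩
    rw [Real.sqrt_lt' hε]
    exact (Real.le_norm_self _).trans_lt (hF G hG)
  obtain ⟨T', hT'⟩ := hsum
  have hTT' : T' = T := by
    ext x
    have h1 : HasSum (fun i => R i x) (T' x) :=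
      hT'.mapL (ContinuousLinearMap.apply 𝕜 E x)
    have h2 : HasSum (fun i => T (b.repr x i • b i)) (T x) := (b.hasSum_repr x).mapL T
    refine h1.unique (h2.congr_fun ?_)
    intro i
    rw [hR_apply, map_smul, b.repr_apply_apply]
  rw [← hTT']
  refine isCompactOperator_of_tendsto hT' (Eventually.of_forall fun G => ?_)
  refine (compactOperator (RingHom.id 𝕜) H E).sum_mem fun i _ => ?_
  have h : IsCompactOperator (ContinuousLinearMap.toSpanSingleton 𝕜 (T (b i))) :=
    isCompactOperator_of_locallyCompactSpace_rng _
  exact h.comp_clm (innerSL 𝕜 (b i))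

/-- A compact symmetric operator on a Hilbert space has a Hilbert basis of eigenvectors. -/
theorem ContinuousLinearMap.exists_hilbertBasis_eigenvectors {𝕜 : Type*} {E : Type*}
    [RCLike 𝕜] [NormedAddCommGroup E] [InnerProductSpace 𝕜 E] [CompleteSpace E]
    (T : E →L[𝕜] E) (hT : IsCompactOperator T) (hT' : T.IsSymmetric) :
    ∃ (w : Set E) (b : HilbertBasis w 𝕜 E) (μ : w → 𝕜), ∀ i, T (b i) = μ i • b i := by
  let V : 𝕜 → Submodule 𝕜 E := fun μ => Module.End.eigenspace (T : Module.End 𝕜 E) μ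
  have hV : ∀ μ, IsClosed (V μ : Set E) := fun μ => by
    have : (V μ : Set E) = {x | T x = μ • x} := by
      ext x; exact Module.End.mem_eigenspace_iff
    rw [this]
    exact isClosed_eq T.continuous (continuous_const_smul μ)
  have hVc : ∀ μ, CompleteSpace (V μ) := fun μ => (hV μ).completeSpace_coe
  choose w b hb using fun μ => exists_hilbertBasis 𝕜 (V μ)
  have horth : Orthonormal 𝕜 (fun p : (Σ μ, w μ) => ((b p.1 p.2 : V p.1) : E)) :=
    hT'.orthogonalFamily_eigenspaces.orthonormal_sigma_orthonormal
      (fun μ => (b μ).orthonormal)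
  have hbot : (Submodule.span 𝕜 (Set.range
      fun x : Set.range (fun p : (Σ μ, w μ) => ((b p.1 p.2 : V p.1) : E)) => (x : E)))ᗮ = ⊥ := by
    rw [Subtype.range_coe, eq_bot_iff, ← T.orthogonalComplement_iSup_eigenspaces_eq_bot hT hT']
    intro x hx
    rw [Submodule.mem_orthogonal'] at hx
    rw [Submodule.mem_orthogonal]
    -- A vector orthogonal to a Hilbert basis of each eigenspace is, by density, orthogonal to all
    -- eigenspaces, hence zero by the spectral theorem.
    have key : ∀ μ, V μ ≤ (Submodule.span 𝕜 {x})ᗮ := by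
      intro μ y hy
      have h1 : Dense ((Submodule.span 𝕜 (Set.range (b μ)) : Submodule 𝕜 (V μ)) : Set (V μ)) :=
        Submodule.dense_iff_topologicalClosure_eq_top.2 (b μ).dense_span
      have h2 : ∀ z : V μ, inner 𝕜 x (z : E) = 0 := by
        have hcl : IsClosed {z : V μ | inner 𝕜 x (z : E) = 0} :=
          isClosed_eq (by fun_prop) continuous_const
        have hsub : ((Submodule.span 𝕜 (Set.range (b μ)) : Submodule 𝕜 (V μ)) : Set (V μ)) ⊆
            {z : V μ | inner 𝕜 x (z : E) = 0} := by
          intro z hz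
          refine hx _ ?_
          have h3 : (V μ).subtype z ∈
              (Submodule.span 𝕜 (Set.range (b μ))).map (V μ).subtype :=
            Submodule.mem_map_of_mem hz
          rw [Submodule.map_span, ← Set.range_comp] at h3
          refine Submodule.span_mono ?_ h3
          rintro _ ⟨i, rfl⟩
          exact ⟨⟨μ, i⟩, rfl⟩
        intro z
        exact hcl.closure_subset_iff.2 hsub (h1 z)
      rw [Submodule.mem_orthogonal_singleton_iff_inner_right]
      exact h2 ⟨y, hy⟩
    intro u hu
    have := (iSup_le key : ⨆ μ, V μ ≤ _) hu
    rw [Submodule.mem_orthogonal_singleton_iff_inner_left] at this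
    exact this
  refine ⟨_, HilbertBasis.mkOfOrthogonalEqBot horth.toSubtypeRange hbot,
    fun i => i.2.choose.1, fun i => ?_⟩
  rw [HilbertBasis.coe_mkOfOrthogonalEqBot]
  have h := (b i.2.choose.1 i.2.choose.2).2
  have h' := i.2.choose_spec
  simp only at h'
  rw [h'] at h
  exact Module.End.mem_eigenspace_iff.1 h

/-! ### Listing the eigenvalues in decreasing order -/

/-- A positive family tending to zero along the cofinite filter can be listed in decreasing order
in a sequence that is padded by zeros. -/
theorem exists_antitone_enumeration {ι : Type*} (μ : ι → ℝ) (hpos : ∀ i, 0 < μ i)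
    (hfin : ∀ ε > 0, {i | ε ≤ μ i}.Finite) :
    ∃ (a : ℕ → ℝ) (e : {n // 0 < a n} ≃ ι), Antitone a ∧ Tendsto a atTop (𝓝 0) ∧
      (∀ n, 0 ≤ a n) ∧ ∀ n, μ (e n) = a n := by
  have hcount : Countable ι := by
    have h : (⋃ n : ℕ, {i | 1 / ((n : ℝ) + 1) ≤ μ i}) = Set.univ := by
      refine Set.eq_univ_of_forall fun i => ?_
      obtain ⟨n, hn⟩ := exists_nat_one_div_lt (hpos i)
      exact Set.mem_iUnion.2 ⟨n, hn.le⟩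
    rw [← Set.countable_univ_iff, ← h]
    exact Set.countable_iUnion fun n => (hfin _ (by positivity)).countable
  obtain ⟨enc, henc⟩ := exists_injective_nat ι
  -- The second coordinate breaks ties between equal values, so `k` orders `ι` strictly; the rank `r
  -- i` counts the finitely many predecessors of `i`.
  let k : ι → ℝ ×ₗ ℕ := fun i => toLex (-μ i, enc i)
  have hk : Function.Injective k := fun i j h => henc (by
    have := congrArg (fun p => (ofLex p).2) h
    simpa [k] using this)
  have hk_le : ∀ {i j}, k i ≤ k j → μ j ≤ μ i := by
    intro i j h
    rcases Prod.Lex.le_iff.1 h with h | h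
    · have : -μ i < -μ j := h
      linarith
    · have : -μ i = -μ j := h.1
      linarith
  let L : ι → Set ι := fun i => {j | k j < k i}
  have hmemL : ∀ {i j}, j ∈ L i ↔ k j < k i := Iff.rfl
  have hL : ∀ i, (L i).Finite := fun i => (hfin (μ i) (hpos i)).subset fun j hj =>
    hk_le (hmemL.1 hj).le
  let r : ι → ℕ := fun i => (L i).ncard
  have hr_lt : ∀ {i j}, k i < k j → r i < r j := by
    intro i j h
    refine Set.ncard_lt_ncard ⟨fun l hl => hmemL.2 ((hmemL.1 hl).trans h), fun hsub => ?_⟩ (hL j)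
    exact lt_irrefl _ (hmemL.1 (hsub (hmemL.2 h)))
  have hr_inj : Function.Injective r := by
    intro i j h
    rcases lt_trichotomy (k i) (k j) with h1 | h1 | h1
    · exact absurd h (hr_lt h1).ne
    · exact hk h1
    · exact absurd h (hr_lt h1).ne'
  have hr_le : ∀ {i j}, r i ≤ r j → μ j ≤ μ i := by
    intro i j h
    refine hk_le (not_lt.1 fun h1 => ?_)
    exact absurd (hr_lt h1) (not_lt.2 h)
  -- Ranks leave no gaps: the immediate predecessor of `i` has rank exactly one less.
  have hr_down : ∀ N i, r i = N → ∀ n < N, ∃ j, r j = n := by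
    intro N
    induction N with
    | zero => intro i _ n hn; omega
    | succ N ih =>
      intro i hi n hn
      have hne : (L i).Nonempty := by
        rw [← Set.ncard_pos (hL i)]
        change 0 < r i
        omega
      obtain ⟨j, hj, hmax⟩ := Set.exists_max_image (L i) k (hL i) hne
      have hLi : L i = insert j (L j) := by
        ext l
        constructor
        · intro hl
          rcases (hmax l hl).lt_or_eq with h | h
          · exact Or.inr h
          · exact Or.inl (hk h)
        · rintro (rfl | h)
          · exact hj
          · exact hmemL.2 ((hmemL.1 h).trans (hmemL.1 hj))
      have hrj : r j = N := by
        have h1 : r i = r j + 1 := by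
          change (L i).ncard = _
          rw [hLi, Set.ncard_insert_of_notMem (fun h => lt_irrefl _ (hmemL.1 h)) (hL j)]
        omega
      rcases (Nat.lt_succ_iff.1 hn).lt_or_eq with h | h
      · exact ih j hrj n h
      · exact ⟨j, hrj.trans h.symm⟩
  let a : ℕ → ℝ := Function.extend r μ 0
  have ha : ∀ i, a (r i) = μ i := fun i => hr_inj.extend_apply _ _ _
  have ha' : ∀ n, (¬∃ i, r i = n) → a n = 0 := fun n h => Function.extend_apply' _ _ _ h
  have ha_nonneg : ∀ n, 0 ≤ a n := by
    intro n
    by_cases h : ∃ i, r i = n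
    · obtain ⟨i, rfl⟩ := h
      exact (ha i).symm ▸ (hpos i).le
    · exact (ha' n h).ge
  have ha_anti : Antitone a := by
    intro n m hnm
    by_cases h : ∃ i, r i = m
    · obtain ⟨j, rfl⟩ := h
      obtain ⟨i, rfl⟩ : ∃ i, r i = n := by
        rcases hnm.lt_or_eq with h | h
        · exact hr_down _ j rfl n h
        · exact ⟨j, h.symm⟩
      rw [ha, ha]
      exact hr_le hnm
    · rw [ha' m h]
      exact ha_nonneg n
  have hmem : ∀ i, 0 < a (r i) := fun i => (ha i).symm ▸ hpos i
  have hbij : Function.Bijective (fun i => (⟨r i, hmem i⟩ : {n // 0 < a n})) := by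
    refine ⟨fun i j h => hr_inj (congrArg Subtype.val h), fun n => ?_⟩
    by_cases h : ∃ i, r i = n
    · obtain ⟨i, hi⟩ := h
      exact ⟨i, Subtype.ext hi⟩
    · exact absurd (ha' n h) n.2.ne'
  refine ⟨a, (Equiv.ofBijective _ hbij).symm, ha_anti, ?_, ha_nonneg, fun n => ?_⟩
  · rw [Metric.tendsto_atTop]
    intro ε hε
    -- Only finitely many ranks carry a value at least `ε`; at any other index the value is below
    -- `ε`, and monotonicity does the rest.
    obtain ⟨n, hn⟩ := ((hfin ε hε).image r).exists_notMem
    refine ⟨n, fun m hm => ?_⟩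
    rw [Real.dist_eq, sub_zero, abs_of_nonneg (ha_nonneg m)]
    refine (ha_anti hm).trans_lt (not_le.1 fun h => hn ?_)
    by_cases h1 : ∃ i, r i = n
    · obtain ⟨i, rfl⟩ := h1
      exact ⟨i, by simpa [ha] using h, rfl⟩
    · rw [ha' n h1] at h
      exact absurd h (not_le.2 hε)
  · rw [← ha]
    exact congrArg (fun x : {n // 0 < a n} => a x) ((Equiv.ofBijective _ hbij).apply_symm_apply n)

/-! ### Uniform convergence on compact sets -/

/-- Dini's theorem for series of nonnegative continuous functions, along the finite sets of
indices. -/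
theorem IsCompact.tendstoUniformlyOn_sum_of_nonneg {S ι : Type*} [TopologicalSpace S] {C : Set S}
    (hC : IsCompact C) {f : ι → S → ℝ} {g : S → ℝ} (hf : ∀ i, Continuous (f i))
    (hf0 : ∀ i s, 0 ≤ f i s) (hg : Continuous g) (h : ∀ s, HasSum (fun i => f i s) (g s)) :
    TendstoUniformlyOn (fun (F : Finset ι) s => ∑ i ∈ F, f i s) g atTop C :=
  Monotone.tendstoUniformlyOn_of_forall_tendsto hC
    (fun F => (continuous_finsetSum F fun i _ => hf i).continuousOn)
    (fun s _ _ _ hFG => Finset.sum_le_sum_of_subset_of_nonneg hFG fun i _ _ => hf0 i s)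
    hg.continuousOn (fun s _ => h s)

/-- Bilinear series inherit locally uniform convergence from their diagonals. -/
theorem IsCompact.tendstoUniformlyOn_sum_mul {S : Type*} [TopologicalSpace S]
    {C : Set (S × S)} (hC : IsCompact C) {u : ℕ → S → ℝ} {g : S → ℝ} {L : S × S → ℝ}
    (hu : ∀ i, Continuous (u i)) (hg : Continuous g)
    (h : ∀ s, HasSum (fun i => u i s ^ 2) (g s))
    (hL : ∀ p : S × S, HasSum (fun i => u i p.1 * u i p.2) (L p)) :
    TendstoUniformlyOn (fun (n : ℕ) (p : S × S) => ∑ i ∈ Finset.range n, u i p.1 * u i p.2)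
      L atTop C := by
  have key : ∀ D : Set S, IsCompact D → TendstoUniformlyOn
      (fun (n : ℕ) s => ∑ i ∈ Finset.range n, u i s ^ 2) g atTop D := fun D hD =>
    Monotone.tendstoUniformlyOn_of_forall_tendsto hD
      (fun n => (continuous_finsetSum _ fun i _ => (hu i).pow 2).continuousOn)
      (fun s _ _ _ hnm => Finset.sum_le_sum_of_subset_of_nonneg
        (Finset.range_mono hnm) fun i _ _ => sq_nonneg _)
      hg.continuousOn (fun s _ => (h s).tendsto_sum_nat)
  have h1 := key _ (hC.image continuous_fst)
  have h2 := key _ (hC.image continuous_snd)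
  rw [Metric.tendstoUniformlyOn_iff] at h1 h2 ⊢
  intro ε hε
  filter_upwards [h1 ε hε, h2 ε hε] with n h1 h2 p hp
  have h1 := h1 p.1 (Set.mem_image_of_mem _ hp)
  have h2 := h2 p.2 (Set.mem_image_of_mem _ hp)
  rw [Real.dist_eq] at h1 h2 ⊢
  have t1 := (hasSum_nat_add_iff' n).2 (h p.1)
  have t2 := (hasSum_nat_add_iff' n).2 (h p.2)
  have t := (hasSum_nat_add_iff' n).2 (hL p)
  have t3 := (t1.add t2).mul_left (1 / 2)
  -- The two bounds say `|xy| ≤ (x² + y²)/2`, so the bilinear tail is at most the mean of the two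
  -- diagonal tails.
  have hle : ∀ i, u (i + n) p.1 * u (i + n) p.2 ≤
      1 / 2 * (u (i + n) p.1 ^ 2 + u (i + n) p.2 ^ 2) := fun i => by
    nlinarith [sq_nonneg (u (i + n) p.1 - u (i + n) p.2)]
  have hge : ∀ i, -(u (i + n) p.1 * u (i + n) p.2) ≤
      1 / 2 * (u (i + n) p.1 ^ 2 + u (i + n) p.2 ^ 2) := fun i => by
    nlinarith [sq_nonneg (u (i + n) p.1 + u (i + n) p.2)]
  have b1 := hasSum_le hle t t3
  have b2 := hasSum_le hge t.neg t3
  rw [abs_lt] at h1 h2 ⊢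
  constructor <;> linarith [h1.2, h2.2]

/-! ### The feature operator and Mercer's theorem -/

section FeatureMap

variable {S H : Type*} [TopologicalSpace S] [MeasurableSpace S] [OpensMeasurableSpace S]
  {υ : Measure S} [NormedAddCommGroup H] [InnerProductSpace ℝ H] {Φ : S → H}

theorem memLp_inner_featureMap (hΦ : Continuous Φ) (hΦ2 : MemLp (fun s => ‖Φ s‖) 2 υ) (h : H) :
    MemLp (fun s => inner ℝ (Φ s) h) 2 υ := by
  refine hΦ2.of_le_mul (c := ‖h‖) ?_ (Eventually.of_forall fun s => ?_)
  · have : Continuous fun s => inner ℝ (Φ s) h := by fun_prop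
    exact this.measurable.aestronglyMeasurable
  · rw [norm_norm, mul_comm]
    exact norm_inner_le_norm _ _

/-- The operator from the feature space to `L²` that sends `h` to the function `s ↦ ⟪Φ s, h⟫`. -/
noncomputable def featureOperator (hΦ : Continuous Φ) (hΦ2 : MemLp (fun s => ‖Φ s‖) 2 υ) :
    H →L[ℝ] Lp ℝ 2 υ :=
  LinearMap.mkContinuous
    { toFun := fun h => (memLp_inner_featureMap hΦ hΦ2 h).toLp _
      map_add' := fun h h' => by
        rw [← MemLp.toLp_add]
        exact MemLp.toLp_congr _ _ (Eventually.of_forall fun s => inner_add_right _ _ _)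
      map_smul' := fun c h => by
        rw [RingHom.id_apply, ← MemLp.toLp_const_smul]
        exact MemLp.toLp_congr _ _ (Eventually.of_forall fun s => real_inner_smul_right _ _ _) }
    ‖hΦ2.toLp _‖ fun h => by
      rw [mul_comm]
      refine Lp.norm_le_mul_norm_of_ae_le_mul ?_
      filter_upwards [(memLp_inner_featureMap hΦ hΦ2 h).coeFn_toLp, hΦ2.coeFn_toLp] with s h1 h2
      rw [LinearMap.coe_mk, AddHom.coe_mk, h1, h2, norm_norm, mul_comm]
      exact norm_inner_le_norm _ _

variable (hΦ : Continuous Φ) (hΦ2 : MemLp (fun s => ‖Φ s‖) 2 υ)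

theorem featureOperator_apply (h : H) :
    featureOperator hΦ hΦ2 h = (memLp_inner_featureMap hΦ hΦ2 h).toLp _ := rfl

theorem coeFn_featureOperator (h : H) :
    featureOperator hΦ hΦ2 h =ᵐ[υ] fun s => inner ℝ (Φ s) h :=
  (memLp_inner_featureMap hΦ hΦ2 h).coeFn_toLp

theorem inner_featureOperator (h : H) (f : Lp ℝ 2 υ) :
    inner ℝ (featureOperator hΦ hΦ2 h) f = ∫ s, inner ℝ (Φ s) h * f s ∂υ := by
  rw [L2.inner_def]
  refine integral_congr_ae ?_
  filter_upwards [coeFn_featureOperator hΦ hΦ2 h] with s hs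
  rw [hs]
  simp [mul_comm]

theorem norm_featureOperator_sq (h : H) :
    ‖featureOperator hΦ hΦ2 h‖ ^ 2 = ∫ s, inner ℝ (Φ s) h ^ 2 ∂υ := by
  rw [← real_inner_self_eq_norm_sq, inner_featureOperator]
  refine integral_congr_ae ?_
  filter_upwards [coeFn_featureOperator hΦ hΦ2 h] with s hs
  rw [hs, sq]

/-- Continuous functions that agree almost everywhere agree everywhere when non-empty open sets have
positive measure. -/
theorem featureOperator_eq_zero_iff [υ.IsOpenPosMeasure] (h : H) :
    featureOperator hΦ hΦ2 h = 0 ↔ ∀ s, inner ℝ (Φ s) h = 0 := by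
  rw [Lp.eq_zero_iff_ae_eq_zero]
  constructor
  · intro h0
    have h1 : (fun s => inner ℝ (Φ s) h) =ᵐ[υ] fun _ => (0 : ℝ) :=
      (coeFn_featureOperator hΦ hΦ2 h).symm.trans h0
    exact fun s => congrFun
      ((Continuous.ae_eq_iff_eq υ (by fun_prop) continuous_const).1 h1) s
  · intro h0
    filter_upwards [coeFn_featureOperator hΦ hΦ2 h] with s hs
    rw [hs, h0]
    rfl

/-- Bessel's inequality for `Φ s`, integrated over `s`. This is the Hilbert-Schmidt bound. -/
theorem sum_norm_featureOperator_sq_le {ι : Type*} {b : ι → H} (hb : Orthonormal ℝ b)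
    (F : Finset ι) : ∑ i ∈ F, ‖featureOperator hΦ hΦ2 (b i)‖ ^ 2 ≤ ∫ s, ‖Φ s‖ ^ 2 ∂υ := by
  simp_rw [norm_featureOperator_sq]
  rw [← integral_finsetSum _ fun i _ => (memLp_inner_featureMap hΦ hΦ2 (b i)).integrable_sq]
  refine integral_mono (integrable_finsetSum _ fun i _ =>
    (memLp_inner_featureMap hΦ hΦ2 (b i)).integrable_sq) hΦ2.integrable_sq fun s => ?_
  refine le_trans (Finset.sum_le_sum fun i _ => ?_) (hb.sum_inner_products_le (Φ s) (s := F))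
  rw [real_inner_comm, Real.norm_eq_abs, sq_abs]

theorem summable_norm_featureOperator_sq {ι : Type*} {b : ι → H} (hb : Orthonormal ℝ b) :
    Summable fun i => ‖featureOperator hΦ hΦ2 (b i)‖ ^ 2 :=
  summable_of_sum_le (fun _ => sq_nonneg _) (sum_norm_featureOperator_sq_le hΦ hΦ2 hb)

variable [CompleteSpace H]

theorem isCompactOperator_featureOperator : IsCompactOperator (featureOperator hΦ hΦ2) := by
  obtain ⟨w, b, -⟩ := exists_hilbertBasis ℝ H
  exact b.isCompactOperator_of_summable_norm_sq _
    (summable_norm_featureOperator_sq hΦ hΦ2 b.orthonormal)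

theorem inner_adjoint_featureOperator (h : H) (f : Lp ℝ 2 υ) :
    inner ℝ h ((featureOperator hΦ hΦ2).adjoint f) = ∫ s, inner ℝ (Φ s) h * f s ∂υ := by
  rw [ContinuousLinearMap.adjoint_inner_right, inner_featureOperator]

/-- The factorisation `𝒦 = D D*`, valid at every point and not only almost everywhere. -/
theorem integralOperator_featureMap (f : Lp ℝ 2 υ) (s : S) :
    integralOperator υ (fun s t => inner ℝ (Φ s) (Φ t)) f s =
      inner ℝ (Φ s) ((featureOperator hΦ hΦ2).adjoint f) := by
  rw [inner_adjoint_featureOperator, integralOperator]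
  simp_rw [real_inner_comm]

open Classical in
/-- The composition of the feature operator with its adjoint has a Hilbert basis of eigenvectors,
with summable eigenvalues. -/
theorem exists_hilbertBasis_featureOperator :
    ∃ (w : Set H) (b : HilbertBasis w ℝ H) (μ : w → ℝ), (∀ i, 0 ≤ μ i) ∧ Summable μ ∧
      (∀ i, (featureOperator hΦ hΦ2).adjoint (featureOperator hΦ hΦ2 (b i)) = μ i • b i) ∧
      ∀ i j, inner ℝ (featureOperator hΦ hΦ2 (b i)) (featureOperator hΦ hΦ2 (b j)) =
        if i = j then μ i else 0 := by
  classical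
  set D := featureOperator hΦ hΦ2
  have hc : IsCompactOperator (D.adjoint ∘L D) :=
    (isCompactOperator_featureOperator hΦ hΦ2).clm_comp D.adjoint
  have hs : (D.adjoint ∘L D).IsSymmetric := fun x y => by
    simp [ContinuousLinearMap.adjoint_inner_left, ContinuousLinearMap.adjoint_inner_right]
  obtain ⟨w, b, μ, hμ⟩ := (D.adjoint ∘L D).exists_hilbertBasis_eigenvectors hc hs
  have hin : ∀ i j, inner ℝ (D (b i)) (D (b j)) = if i = j then μ i else 0 := by
    intro i j
    rw [← ContinuousLinearMap.adjoint_inner_left]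
    have : D.adjoint (D (b i)) = μ i • b i := hμ i
    rw [this, real_inner_smul_left, orthonormal_iff_ite.1 b.orthonormal]
    simp
  have hn : ∀ i, ‖D (b i)‖ ^ 2 = μ i := fun i => by
    rw [← real_inner_self_eq_norm_sq, hin, if_pos rfl]
  refine ⟨w, b, μ, fun i => (hn i).symm ▸ sq_nonneg _, ?_, hμ, hin⟩
  exact (summable_norm_featureOperator_sq hΦ hΦ2 b.orthonormal).congr hn

include hΦ hΦ2 in
/-- **Mercer's theorem** for a continuous kernel with a square integrable feature map. -/
theorem isMercerKernel_inner_featureMap [υ.IsOpenPosMeasure] :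
    IsMercerKernel υ (fun s t => inner ℝ (Φ s) (Φ t)) := by
  classical
  obtain ⟨w, b, μ, hμ0, hμs, hadj, hin⟩ := exists_hilbertBasis_featureOperator hΦ hΦ2
  set D := featureOperator hΦ hΦ2 with hD
  obtain ⟨a, e, ha_anti, ha_lim, ha0, hae⟩ :=
    exists_antitone_enumeration (fun i : {i // 0 < μ i} => μ i) (fun i => i.2) (fun ε hε => by
      have := (hμs.comp_injective (Subtype.val_injective (p := fun i => 0 < μ i)))
      have h := this.tendsto_cofinite_zero.eventually (gt_mem_nhds hε)
      rw [eventually_cofinite] at h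
      simpa using h)
  let g : ℕ → H := fun n => if h : 0 < a n then b (e ⟨n, h⟩) else 0
  have hg : ∀ n : {n // 0 < a n}, g n = b (e n) := fun n => dif_pos n.2
  -- The factor normalises, since `‖D b‖²` is the eigenvalue of `b`. At padded indices `(√0)⁻¹ = 0`
  -- makes `ζ n` vanish.
  let ζ : ℕ → S → ℝ := fun n s => (√(a n))⁻¹ * inner ℝ (Φ s) (g n)
  have hζc : ∀ n, Continuous (ζ n) := fun n => by fun_prop
  have hζm : ∀ n, MemLp (ζ n) 2 υ := fun n =>
    (memLp_inner_featureMap hΦ hΦ2 (g n)).const_mul _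
  have hζD : ∀ n, (hζm n).toLp (ζ n) = (√(a n))⁻¹ • D (g n) := fun n => by
    rw [hD, featureOperator_apply, ← MemLp.toLp_const_smul]
    rfl
  have hζ0 : ∀ n, a n = 0 → ζ n = 0 := fun n h => by
    funext s
    simp [ζ, h]
  have hDzero : ∀ i, ¬0 < μ i → D (b i) = 0 := fun i hi => by
    have : μ i = 0 := le_antisymm (not_lt.1 hi) (hμ0 i)
    rw [← norm_eq_zero, ← sq_eq_zero_iff, ← real_inner_self_eq_norm_sq, hin, if_pos rfl, this]
  have hterm : ∀ n s t, a n * ζ n s * ζ n t = inner ℝ (Φ s) (g n) * inner ℝ (g n) (Φ t) := by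
    intro n s t
    rcases (ha0 n).eq_or_lt with h | h
    · have : g n = 0 := dif_neg h.not_lt
      rw [← h, this]
      simp
    · have h1 : √(a n) ≠ 0 := (Real.sqrt_pos.2 h).ne'
      have h2 : √(a n) * √(a n) = a n := Real.mul_self_sqrt h.le
      simp only [ζ]
      rw [real_inner_comm (Φ t) (g n)]
      field_simp
      rw [sq, h2]
  have hsum : ∀ s t, HasSum (fun n => a n * ζ n s * ζ n t) (inner ℝ (Φ s) (Φ t)) := by
    intro s t
    simp_rw [hterm]
    have h1 := b.hasSum_inner_mul_inner (Φ s) (Φ t)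
    have h2 : HasSum (fun i : {i // 0 < μ i} => inner ℝ (Φ s) (b i) * inner ℝ (b i) (Φ t))
        (inner ℝ (Φ s) (Φ t)) := by
      -- Parseval terms with eigenvalue zero vanish at every point, because `D (b i) = 0`.
      refine (hasSum_subtype_iff_of_support_subset (s := {i | 0 < μ i}) ?_).2 h1
      intro i hi
      by_contra hi'
      refine hi ?_
      have := (featureOperator_eq_zero_iff hΦ hΦ2 (b i)).1 (hDzero i hi') s
      simp [this]
    have h3 := (e.hasSum_iff).2 h2
    refine (hasSum_subtype_iff_of_support_subset (s := {n | 0 < a n}) ?_).1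
      (h3.congr_fun ?_)
    · intro n hn
      by_contra hn'
      have : g n = 0 := dif_neg hn'
      exact hn (by simp [this])
    · intro n
      simp only [Function.comp]
      rw [hg]
  have hsq : ∀ n s t, a n * ζ n s * ζ n t = (√(a n) * ζ n s) * (√(a n) * ζ n t) := by
    intro n s t
    have h2 : √(a n) * √(a n) = a n := Real.mul_self_sqrt (ha0 n)
    linear_combination -(ζ n s * ζ n t) * h2
  have hK : Continuous fun p : S × S => (inner ℝ (Φ p.1) (Φ p.2) : ℝ) := by fun_prop
  have hKd : Continuous fun s : S => (inner ℝ (Φ s) (Φ s) : ℝ) := by fun_prop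
  have hdiag : ∀ s, HasSum (fun n => (√(a n) * ζ n s) ^ 2) (inner ℝ (Φ s) (Φ s)) := fun s => by
    simpa only [hsq, ← sq] using hsum s s
  have hortho : Orthonormal ℝ (fun j : {j : ℕ // 0 < a j} => (hζm j).toLp (ζ j)) := by
    rw [orthonormal_iff_ite]
    intro i j
    rw [hζD, hζD, real_inner_smul_left, real_inner_smul_right, hg, hg, hin]
    by_cases hij : i = j
    · subst hij
      have h1 : √(a i) ≠ 0 := (Real.sqrt_pos.2 i.2).ne'
      have h2 : √(a i) * √(a i) = a i := Real.mul_self_sqrt (ha0 i)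
      rw [if_pos rfl, if_pos rfl, hae]
      field_simp
      rw [sq, h2]
    · rw [if_neg hij, if_neg, mul_zero, mul_zero]
      exact fun h => hij (e.injective (Subtype.ext h))
  obtain ⟨W, c, hW, hcW⟩ := hortho.toSubtypeRange.exists_hilbertBasis_extension
  have hcW' : Orthonormal ℝ ((↑) : W → Lp ℝ 2 υ) := hcW ▸ c.orthonormal
  set v : {j : ℕ // 0 < a j} → Lp ℝ 2 υ := fun j => (hζm j).toLp (ζ j) with hv
  have hrange : Set.range (Sum.elim v
      (fun x : (W \ Set.range v : Set (Lp ℝ 2 υ)) => (x : Lp ℝ 2 υ))) = W := by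
    rw [Set.Sum.elim_range, Subtype.range_coe, Set.union_sdiff_cancel hW]
  refine ⟨a, ζ, ?_⟩
  refine
    { continuous_kernel := hK
      memLp_kernel := fun s => ?_
      antitone := ha_anti
      tendsto_zero := ha_lim
      continuous_eigenfunction := hζc
      memLp_eigenfunction := hζm
      eigenfunction_eq_zero := hζ0
      eigen := fun n s => ?_
      exists_basis := ⟨W \ Set.range v, fun x hx s => ?_, ?_, ?_⟩
      hasSum := fun s t => ?_
      tendstoUniformlyOn := fun C hC => ?_
      tendstoUniformlyOn_norm := fun C hC => ?_ }
  · simp_rw [real_inner_comm _ (Φ s)]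
    exact memLp_inner_featureMap hΦ hΦ2 (Φ s)
  · have h1 : integralOperator υ (fun s t => inner ℝ (Φ s) (Φ t)) (ζ n) s =
        integralOperator υ (fun s t => inner ℝ (Φ s) (Φ t)) ((hζm n).toLp (ζ n)) s := by
      refine integral_congr_ae ?_
      filter_upwards [(hζm n).coeFn_toLp] with t ht
      rw [ht]
    rw [h1, integralOperator_featureMap hΦ hΦ2, hζD, map_smul, real_inner_smul_right]
    rcases (ha0 n).eq_or_lt with h | h
    · simp [← h]
    · rw [hg ⟨n, h⟩, hadj, real_inner_smul_right, hae ⟨n, h⟩, ← hg ⟨n, h⟩]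
      simp only [ζ, RCLike.ofReal_real_eq_id, id]
      ring
  · rw [integralOperator_featureMap hΦ hΦ2]
    -- The coordinates of `D* x` are `⟪D (b i), x⟫`, where `D (b i)` is either zero or a multiple of
    -- some `ζ n`, to which `x` is orthogonal.
    have h0 : (featureOperator hΦ hΦ2).adjoint x = 0 := by
      refine b.repr.injective (lp.ext (funext fun i => ?_))
      rw [b.repr_apply_apply, ContinuousLinearMap.adjoint_inner_right, map_zero]
      by_cases hi : 0 < μ i
      · obtain ⟨n, hn⟩ := e.surjective ⟨i, hi⟩
        have h1 : inner ℝ (v n) x = 0 :=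
          hcW'.2 (i := ⟨v n, hW ⟨n, rfl⟩⟩) (j := ⟨x, hx.1⟩)
            fun h => hx.2 ⟨n, congrArg Subtype.val h⟩
        have h2 : √(a n) ≠ 0 := (Real.sqrt_pos.2 n.2).ne'
        simp only [hv] at h1
        rw [hζD, hg, hn, real_inner_smul_left] at h1
        exact (mul_eq_zero.1 h1).resolve_left (inv_ne_zero h2)
      · rw [← hD, hDzero i hi, inner_zero_left]
        rfl
    rw [h0, inner_zero_right]
  · have hinj : Function.Injective (Sum.elim
        (fun j => (⟨v j, hW ⟨j, rfl⟩⟩ : W))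
        (fun x : (W \ Set.range v : Set (Lp ℝ 2 υ)) => (⟨x, x.2.1⟩ : W))) := by
      refine Function.Injective.sumElim ?_ ?_ ?_
      · intro i j hij
        exact hortho.linearIndependent.injective (congrArg Subtype.val hij)
      · intro x y hxy
        exact Subtype.ext (Subtype.mk.inj hxy)
      · intro i x hix
        exact x.2.2 ⟨i, congrArg Subtype.val hix⟩
    convert hcW'.comp _ hinj using 1
    funext x
    rcases x with x | x <;> rfl
  · rw [hrange]
    have := c.dense_span
    rwa [hcW, Subtype.range_coe] at this
  · simpa using hsum s t
  · simp only [RCLike.ofReal_real_eq_id, id, conj_trivial, hsq]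
    exact hC.tendstoUniformlyOn_sum_mul (u := fun n s => √(a n) * ζ n s)
      (fun n => continuous_const.mul (hζc n)) hKd hdiag
      (fun p => by simpa only [hsq, Function.uncurry] using hsum p.1 p.2)
  · simp only [RCLike.ofReal_real_eq_id, id, conj_trivial, hsq, norm_mul]
    -- Absolute values leave the diagonal series unchanged, so the same bilinear lemma applies.
    refine hC.tendstoUniformlyOn_sum_mul (u := fun n s => ‖√(a n)‖ * ‖ζ n s‖)
      (fun n => continuous_const.mul (hζc n).norm) hKd (fun s => ?_) (fun p => ?_)
    · simpa [mul_pow] using hdiag s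
    · refine Summable.hasSum ?_
      simpa only [hsq, norm_mul] using (hsum p.1 p.2).summable.norm

end FeatureMap

/-! ### The process as a feature map -/

/-- Expand `‖Φ t - Φ s‖²` into three inner products and let `t → s`. -/
theorem continuous_of_continuous_inner {S H : Type*} [TopologicalSpace S] [NormedAddCommGroup H]
    [InnerProductSpace ℝ H] {Φ : S → H}
    (h : Continuous (Function.uncurry fun s t => (inner ℝ (Φ s) (Φ t) : ℝ))) : Continuous Φ := by
  rw [continuous_iff_continuousAt]
  intro s
  rw [ContinuousAt, tendsto_iff_norm_sub_tendsto_zero]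
  have h1 : Continuous fun t => (inner ℝ (Φ t) (Φ t) : ℝ) :=
    h.comp (continuous_id.prodMk continuous_id)
  have h2 : Continuous fun t => (inner ℝ (Φ t) (Φ s) : ℝ) :=
    h.comp (continuous_id.prodMk continuous_const)
  have h3 : Continuous fun t => √(inner ℝ (Φ t) (Φ t) - 2 * inner ℝ (Φ t) (Φ s) +
      inner ℝ (Φ s) (Φ s)) := by fun_prop
  have h4 := h3.tendsto s
  have h5 : (inner ℝ (Φ s) (Φ s) - 2 * inner ℝ (Φ s) (Φ s) + inner ℝ (Φ s) (Φ s) : ℝ) = 0 := by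
    ring
  rw [h5, Real.sqrt_zero] at h4
  refine h4.congr fun t => ?_
  rw [← real_inner_sub_sub_self, real_inner_self_eq_norm_sq, Real.sqrt_sq (norm_nonneg _)]

theorem lintegral_ofReal_sq_eq_eLpNorm_sq {α : Type*} [MeasurableSpace α] (μ : Measure α)
    (f : α → ℝ) : ∫⁻ x, ENNReal.ofReal (f x ^ 2) ∂μ = eLpNorm f 2 μ ^ 2 := by
  rw [eLpNorm_eq_lintegral_rpow_enorm_toReal two_ne_zero ENNReal.ofNat_ne_top,
    ← ENNReal.rpow_natCast, ← ENNReal.rpow_mul]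
  simp only [ENNReal.toReal_ofNat, Nat.cast_ofNat, one_div, ne_eq, OfNat.ofNat_ne_zero,
    not_false_eq_true, inv_mul_cancel₀, ENNReal.rpow_one, ENNReal.rpow_ofNat]
  refine lintegral_congr fun x => ?_
  rw [← enorm_pow, Real.enorm_of_nonneg (sq_nonneg _)]

theorem prod_le_prod_of_le {α β : Type*} [MeasurableSpace α] [MeasurableSpace β]
    {μ μ' : Measure α} {ν ν' : Measure β} [SFinite ν] [SFinite ν'] (hμ : μ ≤ μ') (hν : ν ≤ ν') :
    μ.prod ν ≤ μ'.prod ν' := by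
  refine Measure.le_iff.2 fun s hs => ?_
  rw [Measure.prod_apply hs, Measure.prod_apply hs]
  exact lintegral_mono' hμ fun x => hν _

theorem inner_toLp_eq_integral {S Ω : Type*} [MeasurableSpace Ω] {P : Measure Ω}
    {X : S → Ω → ℝ} (hX : ∀ s, MemLp (X s) 2 P) (s t : S) :
    inner ℝ ((hX s).toLp (X s)) ((hX t).toLp (X t)) = ∫ ω, X s ω * X t ω ∂P := by
  rw [L2.inner_def]
  refine integral_congr_ae ?_
  filter_upwards [(hX s).coeFn_toLp, (hX t).coeFn_toLp] with ω h1 h2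
  rw [h1, h2]
  simp [mul_comm]

theorem covarianceKernel_eq_inner {S Ω : Type*} [MeasurableSpace Ω] {P : Measure Ω}
    {X : S → Ω → ℝ} [IsProbabilityMeasure P] (hX : ∀ s, MemLp (X s) 2 P)
    (hX0 : ∀ s, ∫ ω, X s ω ∂P = 0) :
    covarianceKernel P X = fun s t => inner ℝ ((hX s).toLp (X s)) ((hX t).toLp (X t)) := by
  funext s t
  rw [inner_toLp_eq_integral, covarianceKernel, covariance_eq_sub (hX s) (hX t), hX0, zero_mul,
    sub_zero]
  rfl

theorem klCoeff_eq_setIntegral {S Ω : Type*} [MeasurableSpace S] {υ : Measure S}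
    {X : S → Ω → ℝ} {φ : S → ℝ} {t : Set S} (ht : ∀ s ∉ t, φ s = 0) (ω : Ω) :
    klCoeff υ X φ ω = ∫ s in t, X s ω * φ s ∂υ :=
  (setIntegral_eq_integral_of_forall_compl_eq_zero fun s hs => by simp [ht s hs]).symm

/-! ### Random coefficients of the process -/

section KarhunenLoeve

variable {S Ω : Type*} [MeasurableSpace S] [MeasurableSpace Ω] {υ : Measure S} {P : Measure Ω}
  {X : S → Ω → ℝ}

/-- Integrating over `Ω` first, Tonelli requires s-finiteness of `P` only; `υ` is arbitrary. -/
theorem eLpNorm_uncurry_sq_eq_lintegral [SFinite P]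
    (hm : AEStronglyMeasurable (Function.uncurry X) (υ.prod P)) (hX : ∀ s, MemLp (X s) 2 P) :
    eLpNorm (Function.uncurry X) 2 (υ.prod P) ^ 2 =
      ∫⁻ s, ENNReal.ofReal (∫ ω, X s ω ^ 2 ∂P) ∂υ := by
  rw [← lintegral_ofReal_sq_eq_eLpNorm_sq,
    lintegral_prod _ (hm.aemeasurable.pow_const 2).ennreal_ofReal]
  refine lintegral_congr fun s => ?_
  exact (ofReal_integral_eq_lintegral_ofReal (hX s).integrable_sq
    (Eventually.of_forall fun ω => sq_nonneg _)).symm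

theorem memLp_uncurry_of_lintegral_lt_top [SFinite P]
    (hm : AEStronglyMeasurable (Function.uncurry X) (υ.prod P)) (hX : ∀ s, MemLp (X s) 2 P)
    (hint : ∫⁻ s, ENNReal.ofReal (∫ ω, X s ω ^ 2 ∂P) ∂υ < ⊤) :
    MemLp (Function.uncurry X) 2 (υ.prod P) := by
  refine ⟨hm, ?_⟩
  rw [← eLpNorm_uncurry_sq_eq_lintegral hm hX] at hint
  exact (ENNReal.pow_lt_top_iff.1 hint).resolve_right two_ne_zero

/-- Makes Fubini available for arbitrary `υ`: a square integrable `φ` vanishes off a set on which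
`υ` is σ-finite. -/
theorem exists_sigmaFinite_restrict_klCoeff [IsFiniteMeasure P] {φ : S → ℝ}
    (hφm : StronglyMeasurable φ) (hφ : MemLp φ 2 υ)
    (hX : MemLp (Function.uncurry X) 2 (υ.prod P)) :
    ∃ t, SigmaFinite (υ.restrict t) ∧ (∀ s ∉ t, φ s = 0) ∧
      Integrable (fun p : S × Ω => X p.1 p.2 * φ p.1) ((υ.restrict t).prod P) := by
  obtain ⟨t, -, htφ, ht⟩ := (hφ.finStronglyMeasurable_of_stronglyMeasurable hφm two_ne_zero
    ENNReal.ofNat_ne_top).exists_set_sigmaFinite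
  refine ⟨t, ht, htφ, ?_⟩
  have h1 : MemLp (Function.uncurry X) 2 ((υ.restrict t).prod P) :=
    hX.mono_measure (prod_le_prod_of_le Measure.restrict_le_self le_rfl)
  exact h1.integrable_mul ((hφ.restrict t).comp_fst P)

theorem ae_integrable_mul_of_memLp [IsFiniteMeasure P] {φ : S → ℝ}
    (hφm : StronglyMeasurable φ) (hφ : MemLp φ 2 υ)
    (hX : MemLp (Function.uncurry X) 2 (υ.prod P)) :
    ∀ᵐ ω ∂P, Integrable (fun s => X s ω * φ s) υ := by
  obtain ⟨t, ht, htφ, hint⟩ := exists_sigmaFinite_restrict_klCoeff hφm hφ hX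
  filter_upwards [hint.prod_left_ae] with ω hω
  refine (integrableOn_iff_integrable_of_support_subset ?_).1 hω
  intro s hs
  by_contra hst
  exact hs (by simp [htφ s hst])

theorem integrable_klCoeff [IsFiniteMeasure P] {φ : S → ℝ}
    (hφm : StronglyMeasurable φ) (hφ : MemLp φ 2 υ)
    (hX : MemLp (Function.uncurry X) 2 (υ.prod P)) : Integrable (klCoeff υ X φ) P := by
  obtain ⟨t, ht, htφ, hint⟩ := exists_sigmaFinite_restrict_klCoeff hφm hφ hX
  exact hint.integral_prod_right.congr
    (Eventually.of_forall fun ω => (klCoeff_eq_setIntegral htφ ω).symm)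

theorem integral_klCoeff [IsFiniteMeasure P] {φ : S → ℝ}
    (hφm : StronglyMeasurable φ) (hφ : MemLp φ 2 υ)
    (hX : MemLp (Function.uncurry X) 2 (υ.prod P)) :
    ∫ ω, klCoeff υ X φ ω ∂P = ∫ s, (∫ ω, X s ω ∂P) * φ s ∂υ := by
  obtain ⟨t, ht, htφ, hint⟩ := exists_sigmaFinite_restrict_klCoeff hφm hφ hX
  have h := integral_integral_swap (f := fun s ω => X s ω * φ s) hint
  simp_rw [klCoeff_eq_setIntegral htφ, ← h, integral_mul_const]
  exact setIntegral_eq_integral_of_forall_compl_eq_zero fun s hs => by simp [htφ s hs]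

variable [TopologicalSpace S] [OpensMeasurableSpace S]

/-- Both sides have the same integral over every event `E`: Fubini for `P` restricted to `E` gives
`∫ ⟪Φ s, 1_E⟫ φ(s) dυ = ⟪1_E, D* φ⟫`. -/
theorem klCoeff_ae_eq_adjoint_featureOperator [IsFiniteMeasure P] {φ : S → ℝ}
    (hφm : StronglyMeasurable φ) (hφ : MemLp φ 2 υ)
    (hX : MemLp (Function.uncurry X) 2 (υ.prod P)) (hXs : ∀ s, MemLp (X s) 2 P)
    (hΦ : Continuous fun s => (hXs s).toLp (X s))
    (hΦ2 : MemLp (fun s => ‖(hXs s).toLp (X s)‖) 2 υ) :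
    klCoeff υ X φ =ᵐ[P] (featureOperator hΦ hΦ2).adjoint (hφ.toLp φ) := by
  refine Integrable.ae_eq_of_forall_setIntegral_eq _ _ (integrable_klCoeff hφm hφ hX)
    ((Lp.memLp _).integrable one_le_two) fun E hE _ => ?_
  rw [integral_klCoeff hφm hφ
    (hX.mono_measure (prod_le_prod_of_le le_rfl Measure.restrict_le_self)),
    ← L2.inner_indicatorConstLp_one (𝕜 := ℝ) hE (measure_ne_top P E),
    inner_adjoint_featureOperator]
  refine integral_congr_ae ?_
  filter_upwards [hφ.coeFn_toLp] with s hs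
  rw [hs, real_inner_comm, L2.inner_indicatorConstLp_one hE (measure_ne_top P E),
    setIntegral_congr_ae hE ((hXs s).coeFn_toLp.mono fun ω h _ => h)]

end KarhunenLoeve

/-! ### Consequences of an arbitrary Mercer expansion -/

namespace IsMercerExpansion

variable {S : Type*} [TopologicalSpace S] [MeasurableSpace S] {υ : Measure S}
  {a : ℕ → ℝ} {ζ : ℕ → S → ℝ}

theorem nonneg {K : S → S → ℝ} (hE : IsMercerExpansion υ K a ζ) (j : ℕ) : 0 ≤ a j :=
  hE.antitone.le_of_tendsto hE.tendsto_zero j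

variable {H : Type*} [NormedAddCommGroup H] [InnerProductSpace ℝ H] {Φ : S → H}
  (hE : IsMercerExpansion υ (fun s t => inner ℝ (Φ s) (Φ t)) a ζ)

include hE

theorem hasSum_norm_sq (s : S) : HasSum (fun j => a j * ζ j s ^ 2) (‖Φ s‖ ^ 2) := by
  have h := hE.hasSum s s
  simp only [RCLike.ofReal_real_eq_id, id, conj_trivial] at h
  rw [real_inner_self_eq_norm_sq] at h
  refine h.congr_fun fun j => ?_
  ring

variable [OpensMeasurableSpace S] [CompleteSpace H] (hΦ : Continuous Φ)
  (hΦ2 : MemLp (fun s => ‖Φ s‖) 2 υ)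

theorem inner_adjoint_featureOperator_eigenfunction (j : ℕ) (s : S) :
    inner ℝ (Φ s) ((featureOperator hΦ hΦ2).adjoint
      ((hE.memLp_eigenfunction j).toLp (ζ j))) = a j * ζ j s := by
  rw [← integralOperator_featureMap hΦ hΦ2]
  refine Eq.trans ?_ (hE.eigen j s)
  refine integral_congr_ae ?_
  filter_upwards [(hE.memLp_eigenfunction j).coeFn_toLp] with t ht
  rw [ht]

theorem inner_adjoint_featureOperator_eigenfunctions (j k : ℕ) :
    inner ℝ ((featureOperator hΦ hΦ2).adjoint ((hE.memLp_eigenfunction j).toLp (ζ j)))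
      ((featureOperator hΦ hΦ2).adjoint ((hE.memLp_eigenfunction k).toLp (ζ k))) =
      if j = k then a j else 0 := by
  have h1 : featureOperator hΦ hΦ2 ((featureOperator hΦ hΦ2).adjoint
      ((hE.memLp_eigenfunction k).toLp (ζ k))) =
      a k • (hE.memLp_eigenfunction k).toLp (ζ k) := by
    rw [featureOperator_apply, ← MemLp.toLp_const_smul]
    exact MemLp.toLp_congr _ _ (Eventually.of_forall fun s =>
      hE.inner_adjoint_featureOperator_eigenfunction hΦ hΦ2 k s)
  rw [ContinuousLinearMap.adjoint_inner_left, h1, real_inner_smul_right]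
  -- Orthonormality covers positive eigenvalues only; at padded indices both sides are zero.
  have hzero : ∀ i, a i = 0 → (hE.memLp_eigenfunction i).toLp (ζ i) = 0 := fun i hi => by
    rw [Lp.eq_zero_iff_ae_eq_zero]
    refine (hE.memLp_eigenfunction i).coeFn_toLp.trans ?_
    rw [hE.eigenfunction_eq_zero i hi]
  rcases (hE.nonneg k).eq_or_lt with hk | hk
  · rw [← hk, zero_mul]
    split_ifs with hjk
    · rw [hjk, hk]
    · rfl
  rcases (hE.nonneg j).eq_or_lt with hj | hj
  · rw [hzero j hj.symm, inner_zero_left, mul_zero]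
    split_ifs
    · exact hj
    · rfl
  obtain ⟨B, -, hB, -⟩ := hE.exists_basis
  split_ifs with hjk
  · subst hjk
    have := hB.1 (Sum.inl ⟨j, hj⟩)
    rw [Sum.elim_inl] at this
    rw [real_inner_self_eq_norm_sq, this, one_pow, mul_one]
  · have := hB.inner_eq_zero (i := Sum.inl ⟨j, hj⟩) (j := Sum.inl ⟨k, hk⟩) (by simpa using hjk)
    rw [Sum.elim_inl, Sum.elim_inl] at this
    rw [this, mul_zero]

/-- On expanding the square, the cross term contributes minus twice the diagonal sum and the double
sum contributes it once. -/
theorem norm_featureMap_sub_sum_sq (F : Finset ℕ) (s : S) :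
    ‖Φ s - ∑ j ∈ F, ζ j s • (featureOperator hΦ hΦ2).adjoint
      ((hE.memLp_eigenfunction j).toLp (ζ j))‖ ^ 2 =
      ‖Φ s‖ ^ 2 - ∑ j ∈ F, a j * ζ j s ^ 2 := by
  rw [norm_sub_sq_real, ← real_inner_self_eq_norm_sq (∑ j ∈ F, _), inner_sum, sum_inner]
  simp_rw [inner_sum, real_inner_smul_left, real_inner_smul_right,
    hE.inner_adjoint_featureOperator_eigenfunction hΦ hΦ2,
    hE.inner_adjoint_featureOperator_eigenfunctions hΦ hΦ2]
  have h1 : ∑ j ∈ F, ∑ k ∈ F, ζ j s * (ζ k s * if j = k then a j else 0) =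
      ∑ j ∈ F, a j * ζ j s ^ 2 := by
    refine Finset.sum_congr rfl fun j hj => ?_
    rw [Finset.sum_eq_single_of_mem j hj fun k _ hk => by rw [if_neg hk.symm]; ring, if_pos rfl]
    ring
  have h2 : ∑ j ∈ F, ζ j s * (a j * ζ j s) = ∑ j ∈ F, a j * ζ j s ^ 2 :=
    Finset.sum_congr rfl fun j _ => by ring
  rw [h1, h2]
  ring

end IsMercerExpansion

/-! ### The Karhunen-Loève theorem -/

theorem mainTheorem6 {S Ω : Type*} [TopologicalSpace S] [MeasurableSpace S]
    [OpensMeasurableSpace S] (υ : Measure S) [υ.IsOpenPosMeasure] [IsLocallyFiniteMeasure υ]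
    [MeasurableSpace Ω] (P : Measure Ω) [IsProbabilityMeasure P]
    (X : S → Ω → ℝ)
    (hX_meas : AEStronglyMeasurable (Function.uncurry X) (υ.prod P))
    (hX_memLp : ∀ s, MemLp (X s) 2 P)
    (hX_centered : ∀ s, ∫ ω, X s ω ∂P = 0)
    (hX_cov : Continuous (Function.uncurry (covarianceKernel P X)))
    (hX_int : ∫⁻ s, ENNReal.ofReal (∫ ω, X s ω ^ 2 ∂P) ∂υ < ⊤) :
    IsMercerKernel υ (covarianceKernel P X) ∧
    ∀ (a : ℕ → ℝ) (ζ : ℕ → S → ℝ), IsMercerExpansion υ (covarianceKernel P X) a ζ →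
      -- the coefficients are well defined, centered, uncorrelated, with variances `a j`
      (∀ j, ∀ᵐ ω ∂P, Integrable (fun s => X s ω * ζ j s) υ) ∧
      (∀ j, MemLp (klCoeff υ X (ζ j)) 2 P) ∧
      (∀ j, ∫ ω, klCoeff υ X (ζ j) ω ∂P = 0) ∧
      (∀ j k, ∫ ω, klCoeff υ X (ζ j) ω * klCoeff υ X (ζ k) ω ∂P = if j = k then a j else 0) ∧
      (∀ j, variance (klCoeff υ X (ζ j)) P = a j) ∧
      -- convergence in `L²(S × Ω)`
      (∀ n, MemLp (Function.uncurry (klRemainder υ X ζ (Finset.range n))) 2 (υ.prod P)) ∧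
      Tendsto
        (fun n => eLpNorm (Function.uncurry (klRemainder υ X ζ (Finset.range n))) 2 (υ.prod P))
        atTop (𝓝 0) ∧
      (SFinite υ →
        Tendsto
          (fun n => ∫⁻ ω, ∫⁻ s,
            ENNReal.ofReal (klRemainder υ X ζ (Finset.range n) s ω ^ 2) ∂υ ∂P)
          atTop (𝓝 0)) ∧
      -- convergence in `L²(Ω)` at every point
      (∀ s, Tendsto (fun n => ∫ ω, klRemainder υ X ζ (Finset.range n) s ω ^ 2 ∂P)
        atTop (𝓝 0)) ∧
      -- the mean square convergence is unconditional and uniform on compact sets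
      (∀ C : Set S, IsCompact C →
        TendstoUniformlyOn (fun (F : Finset ℕ) s => ∫ ω, klRemainder υ X ζ F s ω ^ 2 ∂P)
          (fun _ => 0) atTop C) ∧
      -- the second moments of the terms form a series that converges uniformly on compact sets
      (∀ C : Set S, IsCompact C →
        TendstoUniformlyOn
          (fun (n : ℕ) s =>
            ∑ j ∈ Finset.range n, ∫ ω, (klCoeff υ X (ζ j) ω * ζ j s) ^ 2 ∂P)
          (fun s => ∫ ω, X s ω ^ 2 ∂P) atTop C) := by
  let Φ : S → Lp ℝ 2 P := fun s => (hX_memLp s).toLp (X s)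
  have hK : covarianceKernel P X = fun s t => inner ℝ (Φ s) (Φ t) :=
    covarianceKernel_eq_inner hX_memLp hX_centered
  rw [hK] at hX_cov ⊢
  have hΦ : Continuous Φ := continuous_of_continuous_inner hX_cov
  have hnorm : ∀ s, ‖Φ s‖ ^ 2 = ∫ ω, X s ω ^ 2 ∂P := fun s => by
    rw [← real_inner_self_eq_norm_sq, inner_toLp_eq_integral]
    simp_rw [sq]
  have hΦ2 : MemLp (fun s => ‖Φ s‖) 2 υ := by
    refine ⟨hΦ.norm.measurable.aestronglyMeasurable, ?_⟩
    simp_rw [← hnorm] at hX_int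
    rw [lintegral_ofReal_sq_eq_eLpNorm_sq] at hX_int
    exact (ENNReal.pow_lt_top_iff.1 hX_int).resolve_right two_ne_zero
  have hX : MemLp (Function.uncurry X) 2 (υ.prod P) :=
    memLp_uncurry_of_lintegral_lt_top hX_meas hX_memLp hX_int
  refine ⟨isMercerKernel_inner_featureMap hΦ hΦ2, fun a ζ hE => ?_⟩
  have hζm : ∀ j, StronglyMeasurable (ζ j) := fun j =>
    (hE.continuous_eigenfunction j).measurable.stronglyMeasurable
  have hζ : ∀ j, MemLp (ζ j) 2 υ := hE.memLp_eigenfunction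
  set c : ℕ → Lp ℝ 2 P := fun j => (featureOperator hΦ hΦ2).adjoint ((hζ j).toLp (ζ j)) with hc
  have hcoeff : ∀ j, klCoeff υ X (ζ j) =ᵐ[P] c j := fun j =>
    klCoeff_ae_eq_adjoint_featureOperator (hζm j) (hζ j) hX hX_memLp hΦ hΦ2
  have hcoeff_memLp : ∀ j, MemLp (klCoeff υ X (ζ j)) 2 P := fun j =>
    (memLp_congr_ae (hcoeff j)).2 (Lp.memLp _)
  have hcoeff_mean : ∀ j, ∫ ω, klCoeff υ X (ζ j) ω ∂P = 0 := fun j => by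
    rw [integral_klCoeff (hζm j) (hζ j) hX]
    simp [hX_centered]
  have hcoeff_mul : ∀ j k, ∫ ω, klCoeff υ X (ζ j) ω * klCoeff υ X (ζ k) ω ∂P =
      if j = k then a j else 0 := fun j k => by
    rw [← hE.inner_adjoint_featureOperator_eigenfunctions hΦ hΦ2 j k, L2.inner_def]
    refine integral_congr_ae ?_
    filter_upwards [hcoeff j, hcoeff k] with ω h1 h2
    rw [h1, h2]
    simp [hc, mul_comm]
  have hrem_memLp : ∀ F s, MemLp (klRemainder υ X ζ F s) 2 P := fun F s =>
    (hX_memLp s).sub (memLp_finsetSum F fun j _ => (hcoeff_memLp j).mul_const (ζ j s))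
  have hrem : ∀ F s, ∫ ω, klRemainder υ X ζ F s ω ^ 2 ∂P =
      (∫ ω, X s ω ^ 2 ∂P) - ∑ j ∈ F, a j * ζ j s ^ 2 := fun F s => by
    rw [← hnorm, ← hE.norm_featureMap_sub_sum_sq hΦ hΦ2 F s, ← real_inner_self_eq_norm_sq,
      L2.inner_def]
    refine integral_congr_ae ?_
    filter_upwards [(hX_memLp s).coeFn_toLp, Lp.coeFn_sub (Φ s) (∑ j ∈ F, ζ j s • c j),
      Lp.coeFn_fun_finsetSum F (fun j => ζ j s • c j),
      (ae_all_iff.2 fun j => Lp.coeFn_smul (ζ j s) (c j)), ae_all_iff.2 hcoeff]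
      with ω h1 h2 h3 h4 h5
    rw [h2, Pi.sub_apply, h3, h1]
    simp_rw [h4, Pi.smul_apply, ← h5, smul_eq_mul]
    simp [klRemainder, sq, mul_comm]
  have hsum : ∀ s, HasSum (fun j => a j * ζ j s ^ 2) (∫ ω, X s ω ^ 2 ∂P) := fun s =>
    hnorm s ▸ hE.hasSum_norm_sq s
  have hunif : ∀ C : Set S, IsCompact C → TendstoUniformlyOn
      (fun (F : Finset ℕ) s => ∑ j ∈ F, a j * ζ j s ^ 2) (fun s => ∫ ω, X s ω ^ 2 ∂P)
      atTop C := fun C hC =>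
    hC.tendstoUniformlyOn_sum_of_nonneg
      (fun j => continuous_const.mul ((hE.continuous_eigenfunction j).pow 2))
      (fun j s => mul_nonneg (hE.nonneg j) (sq_nonneg _))
      (by simp_rw [← hnorm]; exact hΦ.norm.pow 2) hsum
  have hpoint : ∀ s, Tendsto (fun n => ∫ ω, klRemainder υ X ζ (Finset.range n) s ω ^ 2 ∂P)
      atTop (𝓝 0) := fun s => by
    simp_rw [hrem]
    have h := (hsum s).tendsto_sum_nat.const_sub (∫ ω, X s ω ^ 2 ∂P)
    rwa [sub_self] at h
  have hrem_meas : ∀ n, AEStronglyMeasurable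
      (Function.uncurry (klRemainder υ X ζ (Finset.range n))) (υ.prod P) := fun n =>
    hX_meas.sub (Finset.aestronglyMeasurable_fun_sum _ fun j _ =>
      (hcoeff_memLp j).1.comp_snd.mul (hζ j).1.comp_fst)
  have hrem_le : ∀ n s, ∫ ω, klRemainder υ X ζ (Finset.range n) s ω ^ 2 ∂P ≤
      ∫ ω, X s ω ^ 2 ∂P := fun n s => by
    rw [hrem]
    exact sub_le_self _ (Finset.sum_nonneg fun j _ => mul_nonneg (hE.nonneg j) (sq_nonneg _))
  have hrem_norm := fun n => eLpNorm_uncurry_sq_eq_lintegral (hrem_meas n)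
    (hrem_memLp (Finset.range n))
  have hlim : Tendsto (fun n => ∫⁻ s, ENNReal.ofReal
      (∫ ω, klRemainder υ X ζ (Finset.range n) s ω ^ 2 ∂P) ∂υ) atTop (𝓝 0) := by
    -- The integrable majorant is `E X_s²`, from which the remainder's second moment differs by
    -- subtracting nonnegative terms.
    have h := tendsto_lintegral_of_dominated_convergence (μ := υ)
      (F := fun n s => ENNReal.ofReal (∫ ω, klRemainder υ X ζ (Finset.range n) s ω ^ 2 ∂P))
      (f := fun _ => 0) (fun s => ENNReal.ofReal (∫ ω, X s ω ^ 2 ∂P)) (fun n => ?_)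
      (fun n => Eventually.of_forall fun s => ENNReal.ofReal_le_ofReal (hrem_le n s))
      hX_int.ne (Eventually.of_forall fun s => ?_)
    · simpa using h
    · simp_rw [hrem, ← hnorm]
      refine Measurable.ennreal_ofReal (Continuous.measurable ?_)
      have := hE.continuous_eigenfunction
      fun_prop
    · simpa using ENNReal.tendsto_ofReal (hpoint s)
  refine ⟨fun j => ae_integrable_mul_of_memLp (hζm j) (hζ j) hX, hcoeff_memLp, hcoeff_mean,
    hcoeff_mul, fun j => ?_, fun n => ?_, ?_, fun hυ => ?_, hpoint, fun C hC => ?_,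
    fun C hC => ?_⟩
  · rw [variance_of_integral_eq_zero (hcoeff_memLp j).1.aemeasurable (hcoeff_mean j)]
    simpa [sq] using hcoeff_mul j j
  · exact memLp_uncurry_of_lintegral_lt_top (hrem_meas n) (hrem_memLp _)
      ((lintegral_mono fun s => ENNReal.ofReal_le_ofReal (hrem_le n s)).trans_lt hX_int)
  · have h := (ENNReal.continuous_rpow_const (y := (1 / 2 : ℝ))).tendsto 0 |>.comp hlim
    rw [ENNReal.zero_rpow_of_pos (by norm_num)] at h
    refine h.congr fun n => ?_
    rw [Function.comp_apply, ← hrem_norm, ← ENNReal.rpow_natCast, ← ENNReal.rpow_mul]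
    norm_num
  · refine hlim.congr fun n => ?_
    -- Integrating over `S` first is the one place where `υ` must be s-finite.
    rw [← hrem_norm, ← lintegral_ofReal_sq_eq_eLpNorm_sq,
      lintegral_prod_symm _ ((hrem_meas n).aemeasurable.pow_const 2).ennreal_ofReal]
    rfl
  · have h := hunif C hC
    rw [Metric.tendstoUniformlyOn_iff] at h ⊢
    simpa [hrem, Real.dist_eq, abs_sub_comm] using h
  · have h : ∀ s j, ∫ ω, (klCoeff υ X (ζ j) ω * ζ j s) ^ 2 ∂P = a j * ζ j s ^ 2 := fun s j => by
      have := hcoeff_mul j j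
      rw [if_pos rfl] at this
      simp_rw [mul_pow, integral_mul_const, sq (klCoeff υ X (ζ j) _), this]
    simp_rw [h]
    intro u hu
    -- Initial segments are cofinal among finite index sets.
    exact tendsto_finset_range.eventually (hunif C hC u hu)
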